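/- Let $A$ be an integral domain with field of fractions $K$. A nonzero $g\in A$ is a *strong gcd* of an ideal $I$ of $A$ if for every nonzero $x\in A$ the element $xg$ is a gcd of the elements $xa$ ($a\in I$). $A$ is a *ring with divisors* (a Prüfer $v$-multiplication domain, PvMD) if for every nonzero finitely generated ideal $I$ there is a finitely generated ideal $J$ such that $IJ$ has a strong gcd. In this case the *group of divisors* $\operatorname{Div}A$ is the set of nonzero finitely generated $A$-submodules of $K$, where $I$ and $J$ are identified if they have the same common divisors in $K$ (that is, $I\subseteq yA\iff J\subseteq yA$ for all $y\in K$), with addition induced by $(I,J)\mapsto IJ$ and the order $[I]\le[J]$ if every common divisor in $K$ of the elements of $I$ is a common divisor of the elements of $J$; it is a lattice-ordered abelian group. For $a\in A\setminus\{0\}$ put $\operatorname{div}_A(a)=[aA]\ge 0$. A *Krull domain* is a PvMD $A$ whose group $\operatorname{Div}A$ is discrete (its order is decidable, which is automatic in classical mathematics) and has *bounded decomposition*: for every $x\ge 0$ there is an integer $n\ge 1$ such that whenever $x=x_1+\dots+x_n$ with all $x_j\ge0$, some $x_j$ is zero. **Theorem.** Let $A$ be an integral domain with field of fractions $K$, let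 $L\supseteq K$ be a field of finite dimension over $K$, and let $B$ be the integral closure of $A$ in $L$. 1. If $A$ is a Krull domain, then $B$ is a Krull domain. 2. If $A$ is a PvMD, then $B$ is a PvMD, there is an injective morphism of lattice-ordered groups $\varphi:\operatorname{Div}A\to\operatorname{Div}B$ with $\varphi(\operatorname{div}_A(a))=\operatorname{div}_B(a)$ for all nonzero $a\in A$ (by which $\operatorname{Div}A$ is regarded as a subgroup of $\operatorname{Div}B$), and there is a morphism of ordered groups $N:\operatorname{Div}B\to\operatorname{Div}A$ such that (a) for every nonzero $b\in B$, $\mathrm N_{L/K}(b)$ is a nonzero element of $A$ and $N(\operatorname{div}_B(b))=\operatorname{div}_A(\mathrm N_{L/K}(b))$; (b) for every $\beta\ge 0$ in $\operatorname{Div}B$, $\beta=0$ if and only if $N(\beta)=0$; (c) $N(\varphi(\alpha))=[L:K]\,\alpha$ for every $\alpha\in\operatorname{Div}A$. -/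

import Mathlib

noncomputable section

/-- `g` is a strong gcd of the ideal `I`: for every nonzero `x`, the element `x * g` is a gcd of the
elements `x * a` with `a ∈ I` (equivalently, with `a` in any generating family of `I`). -/
def IsStrongGcd {A : Type*} [CommRing A] (I : Ideal A) (g : A) : Prop :=
  ∀ x : A, x ≠ 0 → (∀ a ∈ I, x * g ∣ x * a) ∧ ∀ d : A, (∀ a ∈ I, d ∣ x * a) → d ∣ x * g

/-- A finitely generated ideal `I` is divisorially invertible if there is a finitely generated ideal
`J` such that `I * J` has a (nonzero) strong gcd. -/
def IsDivisoriallyInvertible {A : Type*} [CommRing A] (I : Ideal A) : Prop :=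
  ∃ J : Ideal A, J.FG ∧ ∃ g : A, g ≠ 0 ∧ IsStrongGcd (I * J) g

/-- Rings with divisors, or Prüfer `v`-multiplication domains: domains in which every nonzero
finitely generated ideal is divisorially invertible. -/
class IsPvMD (A : Type*) [CommRing A] [IsDomain A] : Prop where
  isDivisoriallyInvertible : ∀ I : Ideal A, I.FG → I ≠ ⊥ → IsDivisoriallyInvertible I

section DivisorGroup

variable (A : Type*) [CommRing A] [IsDomain A]

/-- The monoid of nonzero finitely generated `A`-submodules of the fraction field of `A`. -/
def fgFractionalIdeals : Submonoid (Submodule A (FractionRing A)) where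
  carrier := {I | I.FG ∧ I ≠ ⊥}
  one_mem' := by
    refine ⟨?_, ?_⟩
    · rw [Submodule.one_eq_span]
      exact Submodule.fg_span_singleton _
    · rw [Submodule.one_eq_span, Ne, Submodule.span_singleton_eq_bot]
      exact one_ne_zero
  mul_mem' := by
    rintro I J ⟨hI, hI0⟩ ⟨hJ, hJ0⟩
    refine ⟨hI.mul hJ, ?_⟩
    obtain ⟨x, hx, hx0⟩ := I.ne_bot_iff.mp hI0
    obtain ⟨y, hy, hy0⟩ := J.ne_bot_iff.mp hJ0
    exact (Submodule.ne_bot_iff _).mpr ⟨x * y, Submodule.mul_mem_mul hx hy, mul_ne_zero hx0 hy0⟩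

variable {A}

/-- `DivisorLE I J`: every common divisor `y` in the fraction field of the elements of `I` is a common
divisor of the elements of `J`. -/
def DivisorLE (I J : Submodule A (FractionRing A)) : Prop :=
  ∀ y : FractionRing A, I ≤ Submodule.span A {y} → J ≤ Submodule.span A {y}

theorem DivisorLE.trans {I J M : Submodule A (FractionRing A)} (h : DivisorLE I J)
    (h' : DivisorLE J M) : DivisorLE I M := fun y hy => h' y (h y hy)

theorem DivisorLE.mul_right {I J : Submodule A (FractionRing A)} (h : DivisorLE I J)
    (M : Submodule A (FractionRing A)) : DivisorLE (I * M) (J * M) := by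
  intro y hy
  rw [Submodule.mul_le]
  intro j hj m hm
  rcases eq_or_ne m 0 with rfl | hm0
  · simp
  have key : J ≤ Submodule.span A {y * m⁻¹} := by
    apply h
    intro i hi
    obtain ⟨c, hc⟩ := Submodule.mem_span_singleton.mp (hy (Submodule.mul_mem_mul hi hm))
    refine Submodule.mem_span_singleton.mpr ⟨c, ?_⟩
    rw [← smul_mul_assoc, hc, mul_assoc, mul_inv_cancel₀ hm0, mul_one]
  obtain ⟨c, hc⟩ := Submodule.mem_span_singleton.mp (key hj)
  refine Submodule.mem_span_singleton.mpr ⟨c, ?_⟩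
  rw [← hc, smul_mul_assoc, mul_assoc, inv_mul_cancel₀ hm0, mul_one]

theorem DivisorLE.mul_left {I J : Submodule A (FractionRing A)} (h : DivisorLE I J)
    (M : Submodule A (FractionRing A)) : DivisorLE (M * I) (M * J) := by
  rw [mul_comm M I, mul_comm M J]
  exact h.mul_right M

variable (A)

/-- Two finitely generated fractional ideals are identified when they have the same common divisors
in the fraction field. -/
def divisorCon : Con (fgFractionalIdeals A) where
  r I J := DivisorLE I.1 J.1 ∧ DivisorLE J.1 I.1
  iseqv :=
    { refl := fun _ => ⟨fun _ h => h, fun _ h => h⟩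
      symm := fun h => ⟨h.2, h.1⟩
      trans := fun h h' => ⟨h.1.trans h'.1, h'.2.trans h.2⟩ }
  mul' := fun {_ _ _ _} h h' =>
    ⟨(h.1.mul_right _).trans (h'.1.mul_left _), (h.2.mul_right _).trans (h'.2.mul_left _)⟩

/-- The divisors of `A`, written additively: nonzero finitely generated fractional ideals up to having
the same common divisors. The class of `⟨x₁, …, xₙ⟩` is the meet of the principal divisors of the
nonzero `xᵢ`. For a domain with divisors this is a lattice-ordered group, see the instances below. -/
def DivisorGroup : Type _ := Additive (divisorCon A).Quotient

instance : AddCommMonoid (DivisorGroup A) :=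
  inferInstanceAs (AddCommMonoid (Additive (divisorCon A).Quotient))

variable {A}

namespace DivisorGroup

/-- The divisor of a nonzero finitely generated fractional ideal. -/
def mk (I : fgFractionalIdeals A) : DivisorGroup A :=
  Additive.ofMul ((I : (divisorCon A).Quotient))

theorem mk_surjective : Function.Surjective (mk : fgFractionalIdeals A → DivisorGroup A) :=
  fun α => (divisorCon A).mk'_surjective α.toMul

theorem mk_mul (I J : fgFractionalIdeals A) : mk (I * J) = mk I + mk J := rfl

theorem mk_one : mk (1 : fgFractionalIdeals A) = 0 := rfl

theorem mk_eq_mk {I J : fgFractionalIdeals A} :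
    mk I = mk J ↔ DivisorLE I.1 J.1 ∧ DivisorLE J.1 I.1 :=
  (divisorCon A).eq

instance : PartialOrder (DivisorGroup A) where
  le α β := ∀ I J : fgFractionalIdeals A, mk I = α → mk J = β → DivisorLE I.1 J.1
  le_refl α I J hI hJ := (mk_eq_mk.mp (hI.trans hJ.symm)).1
  le_trans α β γ h h' I J hI hJ := by
    obtain ⟨M, hM⟩ := mk_surjective β
    exact (h I M hI hM).trans (h' M J hM hJ)
  le_antisymm α β h h' := by
    obtain ⟨I, rfl⟩ := mk_surjective α
    obtain ⟨J, rfl⟩ := mk_surjective β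
    exact mk_eq_mk.mpr ⟨h I J rfl rfl, h' J I rfl rfl⟩

theorem mk_le_mk {I J : fgFractionalIdeals A} : mk I ≤ mk J ↔ DivisorLE I.1 J.1 := by
  refine ⟨fun h => h I J rfl rfl, fun h I' J' hI hJ => ?_⟩
  exact ((mk_eq_mk.mp hI).1.trans h).trans (mk_eq_mk.mp hJ).2

instance : IsOrderedAddMonoid (DivisorGroup A) where
  add_le_add_left α β h γ := by
    obtain ⟨I, rfl⟩ := mk_surjective α
    obtain ⟨J, rfl⟩ := mk_surjective β
    obtain ⟨M, rfl⟩ := mk_surjective γ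
    rw [← mk_mul, ← mk_mul, mk_le_mk]
    exact (mk_le_mk.mp h).mul_right M.1

theorem exists_isGLB (α β : DivisorGroup A) : ∃ γ, IsGLB {α, β} γ := by
  obtain ⟨I, rfl⟩ := mk_surjective α
  obtain ⟨J, rfl⟩ := mk_surjective β
  have hM : I.1 ⊔ J.1 ∈ fgFractionalIdeals A :=
    ⟨I.2.1.sup J.2.1, fun h => I.2.2 (sup_eq_bot_iff.mp h).1⟩
  refine ⟨mk ⟨I.1 ⊔ J.1, hM⟩, ?_, ?_⟩
  · rintro _ (rfl | rfl)
    · exact mk_le_mk.mpr fun y hy => le_sup_left.trans hy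
    · exact mk_le_mk.mpr fun y hy => le_sup_right.trans hy
  · intro δ hδ
    obtain ⟨M, rfl⟩ := mk_surjective δ
    have h1 := mk_le_mk.mp (hδ (Set.mem_insert _ _))
    have h2 := mk_le_mk.mp (hδ (Set.mem_insert_of_mem _ rfl))
    exact mk_le_mk.mpr fun y hy => sup_le (h1 y hy) (h2 y hy)

theorem exists_neg [IsPvMD A] (α : DivisorGroup A) : ∃ β : DivisorGroup A, β + α = 0 := by
  obtain ⟨⟨I, hI, hI0⟩, rfl⟩ := mk_surjective α
  let f : A →ₗ[A] FractionRing A := Algebra.linearMap A (FractionRing A)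
  have hf : Function.Injective f := IsFractionRing.injective A (FractionRing A)
  -- a common denominator
  obtain ⟨c, hc0, hc⟩ : ∃ c : A, c ≠ 0 ∧ ∀ x ∈ I, ∃ a : A, f a = c • x := by
    obtain ⟨S, rfl⟩ := hI
    obtain ⟨c, hc⟩ := IsLocalization.exist_integer_multiples_of_finset (nonZeroDivisors A) S
    refine ⟨c, nonZeroDivisors.coe_ne_zero c, fun x hx => ?_⟩
    have : Submodule.span A (S : Set (FractionRing A)) ≤
        (LinearMap.range f).comap (LinearMap.lsmul A (FractionRing A) (c : A)) := by
      rw [Submodule.span_le]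
      intro s hs
      exact hc s hs
    exact this hx
  let I' : Ideal A := ((I.map (LinearMap.lsmul A (FractionRing A) c)).comap f)
  have hI' : Submodule.map f I' = I.map (LinearMap.lsmul A (FractionRing A) c) := by
    apply Submodule.map_comap_eq_of_le
    rintro _ ⟨x, hx, rfl⟩
    exact hc x hx
  have hI'fg : I'.FG := by
    apply Submodule.fg_of_fg_map_injective f hf
    rw [hI']
    exact hI.map _
  have hI'0 : I' ≠ ⊥ := by
    obtain ⟨x, hx, hx0⟩ := I.ne_bot_iff.mp hI0
    obtain ⟨a, ha⟩ := hc x hx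
    refine (Submodule.ne_bot_iff _).mpr ⟨a, ⟨x, hx, ha.symm⟩, ?_⟩
    rintro rfl
    rw [map_zero] at ha
    exact (smul_ne_zero hc0 hx0) ha.symm
  obtain ⟨J, hJ, g, hg0, hg⟩ := IsPvMD.isDivisoriallyInvertible I' hI'fg hI'0
  have hJ0 : J ≠ ⊥ := by
    rintro rfl
    have := (hg 1 one_ne_zero).2 0 (by
      intro a ha
      rw [Ideal.mul_bot, Ideal.mem_bot] at ha
      simp [ha])
    rw [one_mul, zero_dvd_iff] at this
    exact hg0 this
  have hg' : f g ≠ 0 := fun h => hg0 (hf (h.trans (map_zero f).symm))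
  have hc' : f c ≠ 0 := fun h => hc0 (hf (h.trans (map_zero f).symm))
  have hfmul : ∀ a b : A, f (a * b) = f a * f b := fun a b => map_mul (algebraMap A _) a b
  have hsm : ∀ (a : A) (x : FractionRing A), a • x = f a * x := fun a x => Algebra.smul_def a x
  let t : FractionRing A := f c * (f g)⁻¹
  have ht : t ≠ 0 := mul_ne_zero hc' (inv_ne_zero hg')
  let J' : Submodule A (FractionRing A) := Submodule.span A {t} * Submodule.map f J
  have hJ' : J' ∈ fgFractionalIdeals A := by
    refine (fgFractionalIdeals A).mul_mem ⟨Submodule.fg_span_singleton _, ?_⟩ ⟨Submodule.FG.map f hJ, ?_⟩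
    · rw [Ne, Submodule.span_singleton_eq_bot]; exact ht
    · obtain ⟨j, hj, hj0⟩ := J.ne_bot_iff.mp hJ0
      exact (Submodule.ne_bot_iff _).mpr
        ⟨f j, ⟨j, hj, rfl⟩, fun h => hj0 (hf (h.trans (map_zero f).symm))⟩
  refine ⟨mk ⟨J', hJ'⟩, ?_⟩
  rw [← mk_mul, ← mk_one, mk_eq_mk]
  -- the elements of the product are the quotients by `g` of the elements of `I' * J`
  have hmem : ∀ a ∈ I' * J, f a * (f g)⁻¹ ∈ J' * I := by
    intro a ha
    refine Submodule.mul_induction_on ha ?_ ?_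
    · rintro i ⟨x, hx, hix⟩ j hj
      have : f (i * j) * (f g)⁻¹ = (t * f j) * x := by
        have h1 : f i = f c * x := by rw [← hix]; exact hsm c x
        rw [hfmul, h1]; ring
      rw [this]
      exact Submodule.mul_mem_mul
        (Submodule.mul_mem_mul (Submodule.mem_span_singleton_self t) ⟨j, hj, rfl⟩) hx
    · intro a b ha hb
      rw [map_add, add_mul]
      exact add_mem ha hb
  have hle : J' * I ≤ 1 := by
    rw [Submodule.mul_le]
    intro z hz x hx
    refine Submodule.mul_induction_on hz ?_ ?_
    · rintro s hs _ ⟨j, hj, rfl⟩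
      obtain ⟨r, rfl⟩ := Submodule.mem_span_singleton.mp hs
      obtain ⟨a, ha⟩ := hc x hx
      have haI : a ∈ I' := ⟨x, hx, ha.symm⟩
      obtain ⟨q, hq⟩ := (hg 1 one_ne_zero).1 (a * j) (Ideal.mul_mem_mul haI hj)
      rw [one_mul, one_mul] at hq
      refine Submodule.mem_one.mpr ⟨r * q, ?_⟩
      change f (r * q) = _
      have h2 : f c * x * f j = f g * f q := by
        rw [← hfmul g q, ← hq, hfmul, ha, hsm]
      rw [hfmul, hsm]
      calc f r * f q = f r * ((f g * f q) * (f g)⁻¹) := by field_simp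
        _ = _ := by rw [← h2]; ring
    · intro u v hu hv
      rw [add_mul]
      exact add_mem hu hv
  constructor
  · intro y hy
    change (1 : Submodule A (FractionRing A)) ≤ _
    rw [Submodule.one_eq_span, Submodule.span_singleton_le_iff_mem]
    obtain ⟨u, v, hv, rfl⟩ := IsFractionRing.div_surjective (A := A) y
    have hv0 : v ≠ 0 := nonZeroDivisors.ne_zero hv
    have hv' : f v ≠ 0 := fun h => hv0 (hf (h.trans (map_zero f).symm))
    have hdvd : g * u ∣ v * g := by
      apply (hg v hv0).2
      intro a ha
      obtain ⟨q, hq⟩ := Submodule.mem_span_singleton.mp (hy (hmem a ha))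
      refine ⟨q, hf ?_⟩
      rw [hsm] at hq
      change f q * (f u / f v) = _ at hq
      rw [hfmul, hfmul, hfmul]
      field_simp at hq
      rw [← hq]
      ring
    obtain ⟨q, hq⟩ := hdvd
    refine Submodule.mem_span_singleton.mpr ⟨q, ?_⟩
    rw [hsm]
    change f q * (f u / f v) = 1
    have h3 : f v * f g = f g * f u * f q := by rw [← hfmul, ← hfmul, ← hfmul, hq]
    have h4 : f v = f u * f q := mul_left_cancel₀ hg' (by rw [mul_comm, h3, mul_assoc])
    rw [mul_div_assoc', mul_comm, ← h4, div_self hv']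
  · intro y hy
    exact hle.trans hy

instance [IsPvMD A] : Neg (DivisorGroup A) := ⟨fun α => (exists_neg α).choose⟩

instance [IsPvMD A] : AddCommGroup (DivisorGroup A) :=
  { (inferInstance : AddCommMonoid (DivisorGroup A)) with
    neg := Neg.neg
    zsmul := zsmulRec
    neg_add_cancel := fun α => (exists_neg α).choose_spec }

instance [IsPvMD A] : Lattice (DivisorGroup A) :=
  { (inferInstance : PartialOrder (DivisorGroup A)) with
    inf := fun α β => (exists_isGLB α β).choose
    inf_le_left := fun α β => (exists_isGLB α β).choose_spec.1 (Set.mem_insert _ _)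
    inf_le_right := fun α β => (exists_isGLB α β).choose_spec.1 (Set.mem_insert_of_mem _ rfl)
    le_inf := fun γ α β h h' => (exists_isGLB α β).choose_spec.2 (by
      rintro _ (rfl | rfl)
      exacts [h, h'])
    sup := fun α β => -(exists_isGLB (-α) (-β)).choose
    le_sup_left := fun α β => le_neg_of_le_neg
      ((exists_isGLB (-α) (-β)).choose_spec.1 (Set.mem_insert _ _))
    le_sup_right := fun α β => le_neg_of_le_neg
      ((exists_isGLB (-α) (-β)).choose_spec.1 (Set.mem_insert_of_mem _ rfl))
    sup_le := fun α β γ h h' => neg_le.mp ((exists_isGLB (-α) (-β)).choose_spec.2 (by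
      rintro _ (rfl | rfl)
      exacts [neg_le_neg h, neg_le_neg h'])) }

/-- The principal divisor of a nonzero element of `A`. -/
def dv (a : A) (ha : a ≠ 0) : DivisorGroup A :=
  mk ⟨Submodule.span A {algebraMap A (FractionRing A) a}, Submodule.fg_span_singleton _, by
    rw [Ne, Submodule.span_singleton_eq_bot]
    exact (map_ne_zero_iff _ (IsFractionRing.injective A (FractionRing A))).mpr ha⟩

end DivisorGroup

end DivisorGroup

/-- A lattice-ordered group has bounded decomposition if for every `x ≥ 0` there is `n ≥ 1` such that
in every decomposition of `x` as a sum of `n` elements `≥ 0`, some summand is zero. -/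
def HasBoundedDecomposition (G : Type*) [AddCommGroup G] [Lattice G] : Prop :=
  ∀ x : G, 0 ≤ x → ∃ n : ℕ, 1 ≤ n ∧
    ∀ y : Fin n → G, (∀ j, 0 ≤ y j) → x = ∑ j, y j → ∃ j, y j = 0

/-- Krull domains: (nontrivial) domains with divisors whose divisor group is discrete, that is, has a
decidable order (which is automatic in classical logic), and has bounded decomposition. -/
class IsKrullDomain (A : Type*) [CommRing A] [IsDomain A] : Prop extends IsPvMD A where
  discrete : Nonempty (DecidableRel fun α β : DivisorGroup A => α ≤ β)
  bounded : HasBoundedDecomposition (DivisorGroup A)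

/-- `φ` is an injective morphism of lattice-ordered groups that maps the principal divisor of `a` over
`A` to the principal divisor of `a` over `B`. Such a morphism is unique, because every divisor is a
difference of finite meets of principal divisors. -/
structure IsDivisorInclusion {A B : Type*} [CommRing A] [IsDomain A] [IsPvMD A] [CommRing B]
    [IsDomain B] [IsPvMD B] [Algebra A B] (φ : DivisorGroup A →+ DivisorGroup B) : Prop where
  injective : Function.Injective φ
  map_inf : ∀ α β, φ (α ⊓ β) = φ α ⊓ φ β
  map_sup : ∀ α β, φ (α ⊔ β) = φ α ⊔ φ β
  map_dv : ∀ (a : A) (ha : a ≠ 0) (hb : algebraMap A B a ≠ 0),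
    φ (DivisorGroup.dv a ha) = DivisorGroup.dv (algebraMap A B a) hb

end

/-! Every divisor is the content of a nonzero polynomial over the fraction field, and over an
integrally closed domain Kronecker's theorem makes contents additive: `contentDivisor_mul`.
Homomorphisms out of the divisor group therefore come from multiplicative, content-monotone maps on
polynomials (`exists_hom_of_contentDivisor`): `φ` from the inclusion of `K[X]` in `L[X]`, `N` from
the determinant of multiplication on `L[X]` over `K[X]`. Nonnegative content means integrality over
`A[X]` (`zero_le_contentDivisor_iff_isIntegral`), which characteristic polynomials control. For `z`
in `L` and `p` in `K[X]`, those of `z * p` have coefficients `c i * p ^ (n - i)`, with `n = [L :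
K]`. Their integrality depends on `p` only through its content, and this makes `φ` well defined. By
Cayley–Hamilton, `f` divides its norm, with a cofactor that is integral whenever `f` is. The norm's
content is invertible over `A`, so that of `f` is invertible over `B`, which gives a PvMD. The same
cofactor makes `N` monotone with trivial kernel on the positive cone, so bounded decomposition
passes from `A` to `B`. -/

/-! ### Gauss's lemma for valuation rings and Kronecker's theorem -/

section Valuation

open Polynomial

/-- Dividing by a coefficient of largest valuation leaves a polynomial over `V` with a coefficient
equal to `1`, hence with nonzero reduction. -/
theorem ValuationSubring.exists_C_mul_eq {F : Type*} [Field F] (V : ValuationSubring F) {f : F[X]}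
    (hf : f ≠ 0) : ∃ (c : F) (g : V[X]), f = C c * g.map (algebraMap V F) ∧
      g.map (IsLocalRing.residue V) ≠ 0 ∧ ∀ i, ∃ v : V, f.coeff i = c * v := by
  obtain ⟨i, hi, hmax⟩ := f.support.exists_max_image (fun i => V.valuation (f.coeff i))
    (support_nonempty.mpr hf)
  have hi0 : f.coeff i ≠ 0 := mem_support_iff.mp hi
  have hV : ∀ j, ∃ v : V, f.coeff j = f.coeff i * v := by
    intro j
    have : f.coeff j / f.coeff i ∈ V := by
      rw [← V.valuation_le_one_iff, map_div₀]
      by_cases hj : f.coeff j = 0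
      · simp [hj]
      · exact (div_le_one₀ (zero_lt_iff.mpr ((_root_.map_ne_zero _).mpr hi0))).mpr
          (hmax j (mem_support_iff.mpr hj))
    exact ⟨⟨_, this⟩, (mul_div_cancel₀ _ hi0).symm⟩
  have hlift : C (f.coeff i)⁻¹ * f ∈ lifts (algebraMap V F) := by
    rw [lifts_iff_coeff_lifts]
    intro j
    obtain ⟨v, hv⟩ := hV j
    refine ⟨v, ?_⟩
    rw [coeff_C_mul, hv, ← mul_assoc, inv_mul_cancel₀ hi0, one_mul]
    rfl
  obtain ⟨g, hg⟩ := (mem_lifts _).mp hlift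
  refine ⟨f.coeff i, g, ?_, ?_, hV⟩
  · rw [hg, ← mul_assoc, ← C_mul, mul_inv_cancel₀ hi0, C_1, one_mul]
  · have h1 : g.coeff i = 1 := by
      apply IsFractionRing.injective V F
      rw [← coeff_map, hg, coeff_C_mul, inv_mul_cancel₀ hi0, map_one]
    intro h
    have := congrArg (fun p => coeff p i) h
    simp [h1] at this

/-- Gauss's lemma: the reductions of the primitive parts have nonzero product, so some coefficient
of the product of the primitive parts is a unit. Hence `c * d` lies in `V`. -/
theorem ValuationSubring.coeff_mul_coeff_mem {F : Type*} [Field F] (V : ValuationSubring F)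
    {f g : F[X]} (h : ∀ i, (f * g).coeff i ∈ V) (i j : ℕ) : f.coeff i * g.coeff j ∈ V := by
  by_cases hf : f = 0
  · simp [hf, V.zero_mem]
  by_cases hg : g = 0
  · simp [hg, V.zero_mem]
  obtain ⟨c, f', hf', hfp, hfc⟩ := V.exists_C_mul_eq hf
  obtain ⟨d, g', hg', hgp, hgc⟩ := V.exists_C_mul_eq hg
  obtain ⟨v, hv⟩ := hfc i
  obtain ⟨w, hw⟩ := hgc j
  have hcd : c * d ∈ V := by
    have hfg' := mul_ne_zero hfp hgp
    rw [← Polynomial.map_mul, Ne, Polynomial.ext_iff, not_forall] at hfg'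
    obtain ⟨k, hk⟩ := hfg'
    rw [coeff_map, coeff_zero, ← Ne, IsLocalRing.residue_ne_zero_iff_isUnit] at hk
    obtain ⟨u, hu⟩ := hk
    have hfg : (f * g).coeff k = c * d * (u : V) := by
      rw [hf', hg', show C c * f'.map (algebraMap V F) * (C d * g'.map (algebraMap V F)) =
        C (c * d) * (f' * g').map (algebraMap V F) by rw [Polynomial.map_mul, C_mul]; ring,
        coeff_C_mul, coeff_map, hu]
      rfl
    have huu : ((u : V) : F) * ((u⁻¹ : Vˣ) : V) = 1 := by
      rw [← V.coe_mul, u.mul_inv, V.coe_one]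
    rw [← mul_one (c * d), ← huu, ← mul_assoc, ← hfg]
    exact V.mul_mem _ _ (h k) (u⁻¹ : Vˣ).1.2
  rw [hv, hw, show c * v * (d * w) = c * d * (v * w : V) by push_cast; ring]
  exact V.mul_mem _ _ hcd (v * w).2

/-- Kronecker's theorem for integrally closed domains. -/
theorem Polynomial.coeff_mul_coeff_mem_range {R F : Type*} [CommRing R] [IsDomain R] [Field F]
    [Algebra R F] [IsFractionRing R F] [IsIntegrallyClosed R] {f g : F[X]}
    (h : ∀ i, (f * g).coeff i ∈ (algebraMap R F).range) (i j : ℕ) :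
    f.coeff i * g.coeff j ∈ (algebraMap R F).range := by
  have : IsIntegrallyClosedIn (algebraMap R F).range F := by
    rw [Subring.isIntegrallyClosedIn_iff]
    intro x hx
    obtain ⟨y, hy⟩ := IsIntegrallyClosed.isIntegral_iff (R := R) (K := F) (x := x) |>.mp (by
      obtain ⟨p, hp, hpx⟩ := hx
      obtain ⟨q, hqp, -, hq⟩ := lifts_and_natDegree_eq_and_monic (f := (algebraMap R F).rangeRestrict)
        (p := p) (by
          rw [lifts_iff_coeff_lifts]
          exact fun n => (algebraMap R F).rangeRestrict_surjective _) hp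
      refine ⟨q, hq, ?_⟩
      rw [← hqp, eval₂_map] at hpx
      exact hpx)
    exact ⟨y, hy⟩
  by_contra hx
  -- An integrally closed subring of a field is the intersection of the valuation rings that contain
  -- it.
  obtain ⟨V, hV, hxV⟩ := Subring.exists_le_valuationSubring_of_isIntegrallyClosedIn hx
  exact hxV (V.coeff_mul_coeff_mem (fun k => hV (h k)) i j)

end Valuation

/-! ### Divisors as contents of polynomials -/

namespace DivisorGroup

open Polynomial

variable {R : Type*} [CommRing R] [IsDomain R]

/-- The submodule generated by the coefficients of a polynomial over the fraction field. -/
def coeffSpan (f : (FractionRing R)[X]) : Submodule R (FractionRing R) :=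
  Submodule.span R (Set.range f.coeff)

theorem coeffSpan_le {f : (FractionRing R)[X]} {M : Submodule R (FractionRing R)} :
    coeffSpan f ≤ M ↔ ∀ i, f.coeff i ∈ M := by
  rw [coeffSpan, Submodule.span_le, Set.range_subset_iff]
  rfl

theorem coeffSpan_mem {f : (FractionRing R)[X]} (hf : f ≠ 0) :
    coeffSpan f ∈ fgFractionalIdeals R := by
  constructor
  · refine Submodule.fg_span ((f.coeffs.finite_toSet.insert 0).subset ?_)
    rintro _ ⟨i, rfl⟩
    by_cases hi : f.coeff i = 0
    · exact Or.inl hi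
    · exact Or.inr (coeff_mem_coeffs hi)
  · refine (Submodule.ne_bot_iff _).mpr ⟨f.leadingCoeff, Submodule.subset_span ⟨_, rfl⟩, ?_⟩
    exact leadingCoeff_ne_zero.mpr hf

open Classical in
/-- The divisor generated by the coefficients of a nonzero polynomial over the fraction field
(and `0` for the zero polynomial). -/
noncomputable def contentDivisor (f : (FractionRing R)[X]) : DivisorGroup R :=
  if hf : f ≠ 0 then mk ⟨coeffSpan f, coeffSpan_mem hf⟩ else 0

theorem contentDivisor_of_ne_zero {f : (FractionRing R)[X]} (hf : f ≠ 0) :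
    contentDivisor f = mk ⟨coeffSpan f, coeffSpan_mem hf⟩ := dif_pos hf

theorem contentDivisor_le {f g : (FractionRing R)[X]} (hf : f ≠ 0) (hg : g ≠ 0) :
    contentDivisor f ≤ contentDivisor g ↔ DivisorLE (coeffSpan f) (coeffSpan g) := by
  rw [contentDivisor_of_ne_zero hf, contentDivisor_of_ne_zero hg, mk_le_mk]

theorem coeffSpan_C (x : FractionRing R) : coeffSpan (C x) = Submodule.span R {x} := by
  apply le_antisymm
  · rw [coeffSpan_le]
    intro i
    rw [coeff_C]
    split_ifs
    · exact Submodule.mem_span_singleton_self x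
    · exact zero_mem _
  · rw [Submodule.span_singleton_le_iff_mem]
    exact Submodule.subset_span ⟨0, coeff_C_zero⟩

theorem contentDivisor_C_algebraMap {a : R} (ha : a ≠ 0) :
    contentDivisor (C (algebraMap R (FractionRing R) a)) = dv a ha := by
  rw [contentDivisor_of_ne_zero (C_ne_zero.mpr
    ((map_ne_zero_iff _ (IsFractionRing.injective R (FractionRing R))).mpr ha)), dv]
  congr 2
  exact coeffSpan_C _

theorem contentDivisor_one : contentDivisor (1 : (FractionRing R)[X]) = 0 := by
  rw [contentDivisor_of_ne_zero one_ne_zero, ← mk_one]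
  congr 2
  rw [← C_1, coeffSpan_C, Submodule.one_eq_span]

theorem exists_contentDivisor_eq (α : DivisorGroup R) :
    ∃ f : (FractionRing R)[X], f ≠ 0 ∧ contentDivisor f = α := by
  obtain ⟨⟨I, ⟨S, rfl⟩, hI0⟩, rfl⟩ := mk_surjective α
  let e := S.equivFin
  let f : (FractionRing R)[X] := ∑ i : Fin S.card, monomial (i : ℕ) (e.symm i : FractionRing R)
  have hcoeff : ∀ i : Fin S.card, f.coeff i = e.symm i := by
    intro i
    simp [f, coeff_monomial, Fin.val_inj]
  have hspan : coeffSpan f = Submodule.span R (S : Set (FractionRing R)) := by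
    apply le_antisymm
    · rw [coeffSpan_le]
      intro i
      by_cases hi : i < S.card
      · rw [hcoeff ⟨i, hi⟩]
        exact Submodule.subset_span (e.symm _).2
      · have : f.coeff i = 0 := by
          simp only [f, finsetSum_coeff, coeff_monomial]
          refine Finset.sum_eq_zero fun j _ => if_neg ?_
          have := j.2
          omega
        rw [this]
        exact zero_mem _
    · rw [Submodule.span_le]
      intro s hs
      refine Submodule.subset_span ⟨e ⟨s, hs⟩, ?_⟩
      rw [hcoeff, Equiv.symm_apply_apply]
  have hf : f ≠ 0 := by
    rintro h
    apply hI0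
    rw [← hspan, eq_bot_iff, coeffSpan_le]
    simp [h]
  refine ⟨f, hf, ?_⟩
  rw [contentDivisor_of_ne_zero hf]
  congr 2

theorem mem_one_iff {x : FractionRing R} :
    x ∈ (1 : Submodule R (FractionRing R)) ↔ x ∈ (algebraMap R (FractionRing R)).range :=
  Submodule.mem_one

theorem divisorLE_one_left {J : Submodule R (FractionRing R)} :
    DivisorLE 1 J ↔ J ≤ 1 := by
  refine ⟨fun h => ?_, fun h y hy => h.trans hy⟩
  have := h 1
  rw [← Submodule.one_eq_span] at this
  exact this le_rfl

theorem zero_le_contentDivisor {f : (FractionRing R)[X]} (hf : f ≠ 0) :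
    0 ≤ contentDivisor f ↔ ∀ i, f.coeff i ∈ (algebraMap R (FractionRing R)).range := by
  rw [contentDivisor_of_ne_zero hf, ← mk_one, mk_le_mk]
  refine divisorLE_one_left.trans (coeffSpan_le.trans (forall_congr' fun i => mem_one_iff))

theorem mem_span_singleton_iff_div {x y : FractionRing R} (hy : y ≠ 0) :
    x ∈ Submodule.span R {y} ↔ y⁻¹ * x ∈ (algebraMap R (FractionRing R)).range := by
  rw [Submodule.mem_span_singleton]
  refine exists_congr fun a => ?_
  rw [Algebra.smul_def, eq_inv_mul_iff_mul_eq₀ hy, mul_comm]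

theorem ne_zero_of_coeffSpan_le {f : (FractionRing R)[X]} (hf : f ≠ 0) {y : FractionRing R}
    (h : coeffSpan f ≤ Submodule.span R {y}) : y ≠ 0 := by
  rintro rfl
  have := coeffSpan_le.mp h f.natDegree
  rw [Submodule.span_zero_singleton, Submodule.mem_bot] at this
  exact leadingCoeff_ne_zero.mpr hf this

/-- The span of the coefficients of `f * g` may be smaller than the product of the two spans, but
Kronecker's theorem, applied to `y⁻¹ * f` and `g`, shows that it has no further common divisors `y`.
-/
theorem contentDivisor_mul [IsIntegrallyClosed R] {f g : (FractionRing R)[X]} (hf : f ≠ 0)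
    (hg : g ≠ 0) : contentDivisor (f * g) = contentDivisor f + contentDivisor g := by
  rw [contentDivisor_of_ne_zero hf, contentDivisor_of_ne_zero hg,
    contentDivisor_of_ne_zero (mul_ne_zero hf hg), ← mk_mul, mk_eq_mk]
  constructor
  · intro y hy
    change coeffSpan (f * g) ≤ _ at hy
    have hy0 := ne_zero_of_coeffSpan_le (mul_ne_zero hf hg) hy
    rw [coeffSpan_le] at hy
    change coeffSpan f * coeffSpan g ≤ _
    rw [coeffSpan, coeffSpan, Submodule.span_mul_span, Submodule.span_le]
    rintro _ ⟨_, ⟨i, rfl⟩, _, ⟨j, rfl⟩, rfl⟩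
    have := coeff_mul_coeff_mem_range (R := R) (f := C y⁻¹ * f) (g := g) (fun k => by
      rw [mul_assoc, coeff_C_mul]
      exact (mem_span_singleton_iff_div hy0).mp (hy k)) i j
    rw [coeff_C_mul, mul_assoc] at this
    exact (mem_span_singleton_iff_div hy0).mpr this
  · intro y hy
    refine le_trans ?_ hy
    change coeffSpan (f * g) ≤ coeffSpan f * coeffSpan g
    rw [coeffSpan_le]
    intro k
    rw [coeff_mul]
    exact sum_mem fun c _ => Submodule.mul_mem_mul (Submodule.subset_span ⟨_, rfl⟩)
      (Submodule.subset_span ⟨_, rfl⟩)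

theorem contentDivisor_pow [IsIntegrallyClosed R] {f : (FractionRing R)[X]} (hf : f ≠ 0) (n : ℕ) :
    contentDivisor (f ^ n) = n • contentDivisor f := by
  induction n with
  | zero => rw [pow_zero, contentDivisor_one, zero_nsmul]
  | succ n ih => rw [pow_succ, contentDivisor_mul (pow_ne_zero n hf) hf, ih, succ_nsmul]

/-- The shift by `n` exceeds the degree of `f`, so the coefficients of `f` and `g` do not overlap
and the coefficient span is the sum of the two. -/
theorem isGLB_contentDivisor {f g : (FractionRing R)[X]} (hf : f ≠ 0) (hg : g ≠ 0) {n : ℕ}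
    (hn : f.natDegree < n) : f + X ^ n * g ≠ 0 ∧
      IsGLB {contentDivisor f, contentDivisor g} (contentDivisor (f + X ^ n * g)) := by
  have h1 : ∀ i, (f + X ^ n * g).coeff (i + n) = g.coeff i := by
    intro i
    rw [coeff_add, coeff_X_pow_mul, coeff_eq_zero_of_natDegree_lt (by omega), zero_add]
  have h0 : f + X ^ n * g ≠ 0 := by
    intro h
    apply hg
    ext i
    rw [← h1, h]
    simp
  have hspan : coeffSpan (f + X ^ n * g) = coeffSpan f ⊔ coeffSpan g := by
    apply le_antisymm
    · rw [coeffSpan_le]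
      intro i
      rw [coeff_add, coeff_X_pow_mul']
      refine add_mem (Submodule.mem_sup_left (Submodule.subset_span ⟨_, rfl⟩)) ?_
      split_ifs
      · exact Submodule.mem_sup_right (Submodule.subset_span ⟨_, rfl⟩)
      · exact zero_mem _
    · refine sup_le (coeffSpan_le.mpr fun i => ?_) (coeffSpan_le.mpr fun i => ?_)
      · by_cases hi : i < n
        · refine Submodule.subset_span ⟨i, ?_⟩
          rw [coeff_add, coeff_X_pow_mul', if_neg (by omega), add_zero]
        · rw [coeff_eq_zero_of_natDegree_lt (by omega)]
          exact zero_mem _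
      · exact Submodule.subset_span ⟨i + n, h1 i⟩
  refine ⟨h0, ?_, ?_⟩
  · rintro _ (rfl | rfl)
    · rw [contentDivisor_le h0 hf, hspan]
      exact fun y hy => le_sup_left.trans hy
    · rw [contentDivisor_le h0 hg, hspan]
      exact fun y hy => le_sup_right.trans hy
  · intro δ hδ
    obtain ⟨k, hk, rfl⟩ := exists_contentDivisor_eq δ
    have h1 := (contentDivisor_le hk hf).mp (hδ (Set.mem_insert _ _))
    have h2 := (contentDivisor_le hk hg).mp (hδ (Set.mem_insert_of_mem _ rfl))
    rw [contentDivisor_le hk h0, hspan]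
    exact fun y hy => sup_le (h1 y hy) (h2 y hy)

/-- A domain with divisors is integrally closed. -/
theorem _root_.IsPvMD.isIntegrallyClosed [IsPvMD R] : IsIntegrallyClosed R := by
  rw [isIntegrallyClosed_iff (FractionRing R)]
  intro x hx
  let I : Submodule R (FractionRing R) := Subalgebra.toSubmodule (Algebra.adjoin R {x})
  have hI : I ∈ fgFractionalIdeals R := by
    refine ⟨hx.fg_adjoin_singleton, (Submodule.ne_bot_iff _).mpr ⟨1, ?_, one_ne_zero⟩⟩
    exact one_mem (Algebra.adjoin R {x})
  -- For `x` integral, `R[x]` is finitely generated and idempotent, so its divisor vanishes in the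
  -- group; this forces `R[x]` into `R`.
  have hII : (⟨I, hI⟩ : fgFractionalIdeals R) * ⟨I, hI⟩ = ⟨I, hI⟩ :=
    Subtype.ext ((Algebra.adjoin R {x}).isIdempotentElem_toSubmodule)
  have h0 : mk (⟨I, hI⟩ : fgFractionalIdeals R) = 0 := by
    have := congrArg mk hII
    rwa [mk_mul, add_eq_left] at this
  rw [← mk_one, mk_eq_mk] at h0
  have hI1 : I ≤ 1 := divisorLE_one_left.mp h0.2
  exact mem_one_iff.mp (hI1 (Algebra.self_mem_adjoin_singleton R x))

theorem _root_.isPvMD_of_forall_exists_add_eq_zero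
    (h : ∀ α : DivisorGroup R, ∃ β, α + β = 0) : IsPvMD R := by
  refine ⟨fun I hI hI0 => ?_⟩
  let f : R →ₗ[R] FractionRing R := Algebra.linearMap R (FractionRing R)
  have hf : Function.Injective f := IsFractionRing.injective R (FractionRing R)
  have hI' : Submodule.map f I ∈ fgFractionalIdeals R :=
    ⟨Submodule.FG.map f hI, fun h => hI0 (Submodule.map_injective_of_injective hf (h.trans (Submodule.map_bot f).symm))⟩
  obtain ⟨β, hβ⟩ := h (mk ⟨_, hI'⟩)
  obtain ⟨⟨J', hJ', hJ0⟩, rfl⟩ := mk_surjective β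
  rw [← mk_mul, ← mk_one, mk_eq_mk] at hβ
  obtain ⟨hβ1, hβ2⟩ := hβ
  change DivisorLE (Submodule.map f I * J') 1 at hβ1
  change DivisorLE 1 (Submodule.map f I * J') at hβ2
  rw [divisorLE_one_left] at hβ2
  obtain ⟨c, hc0, hc⟩ : ∃ c : R, c ≠ 0 ∧ ∀ x ∈ J', ∃ a : R, f a = f c * x := by
    obtain ⟨S, rfl⟩ := hJ'
    obtain ⟨c, hc⟩ := IsLocalization.exist_integer_multiples_of_finset (nonZeroDivisors R) S
    refine ⟨c, nonZeroDivisors.coe_ne_zero c, fun x hx => ?_⟩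
    have : Submodule.span R (S : Set (FractionRing R)) ≤
        (LinearMap.range f).comap (LinearMap.lsmul R (FractionRing R) (c : R)) := by
      rw [Submodule.span_le]
      intro s hs
      exact hc s hs
    obtain ⟨a, ha⟩ := this hx
    exact ⟨a, ha.trans (Algebra.smul_def _ _)⟩
  have hc' : f c ≠ 0 := fun h => hc0 (hf (h.trans (map_zero f).symm))
  have hfmul : ∀ a b : R, f (a * b) = f a * f b := fun a b => map_mul (algebraMap R _) a b
  let J : Ideal R := (J'.map (LinearMap.lsmul R (FractionRing R) c)).comap f
  have hJmem : ∀ x, x ∈ J ↔ ∃ y ∈ J', f c * y = f x := fun x => by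
    simp only [J, Submodule.mem_comap, Submodule.mem_map, LinearMap.lsmul_apply, Algebra.smul_def]
    rfl
  have hJ : Submodule.map f J = J'.map (LinearMap.lsmul R (FractionRing R) c) := by
    apply Submodule.map_comap_eq_of_le
    rintro _ ⟨x, hx, rfl⟩
    obtain ⟨a, ha⟩ := hc x hx
    refine ⟨a, ha.trans ?_⟩
    rw [LinearMap.lsmul_apply, Algebra.smul_def]
    rfl
  -- With `J = c J'` the product `I * J` is `c` times `I * J'`, whose divisor is zero; hence `c` is
  -- the strong gcd.
  refine ⟨J, Submodule.fg_of_fg_map_injective f hf (hJ ▸ hJ'.map _), c, hc0, fun x hx => ⟨?_, ?_⟩⟩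
  · intro a ha
    refine mul_dvd_mul_left x ?_
    rw [← Ideal.mem_span_singleton]
    suffices I * J ≤ Ideal.span {c} from this ha
    rw [Ideal.mul_le]
    intro i hi j hj
    obtain ⟨y, hy, hyj⟩ := (hJmem j).mp hj
    obtain ⟨q, hq⟩ := mem_one_iff.mp (hβ2 (Submodule.mul_mem_mul ⟨i, hi, rfl⟩ hy))
    rw [Ideal.mem_span_singleton]
    refine ⟨q, hf ?_⟩
    rw [hfmul, hfmul, ← hyj]
    change _ = f c * algebraMap R _ q
    rw [hq]
    ring
  · intro d hd
    have hx' : f x ≠ 0 := fun h => hx (hf (h.trans (map_zero f).symm))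
    -- That `d` divides `x * I * J` says that `d / (x * c)` is a common divisor of `I * J'`, hence
    -- of `1`.
    have key : Submodule.map f I * J' ≤ Submodule.span R {f d / (f x * f c)} := by
      rw [Submodule.mul_le]
      rintro _ ⟨i, hi, rfl⟩ y hy
      obtain ⟨j, hj⟩ := hc y hy
      obtain ⟨q, hq⟩ := hd (i * j) (Ideal.mul_mem_mul hi ((hJmem j).mpr ⟨y, hy, hj.symm⟩))
      refine Submodule.mem_span_singleton.mpr ⟨q, ?_⟩
      have := congrArg f hq
      rw [hfmul, hfmul, hfmul, hj] at this
      rw [Algebra.smul_def]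
      change f q * _ = _
      field_simp
      linear_combination -this
    have h1 := hβ1 _ key
    rw [Submodule.one_eq_span, Submodule.span_singleton_le_iff_mem] at h1
    obtain ⟨q, hq⟩ := Submodule.mem_span_singleton.mp h1
    refine ⟨q, hf ?_⟩
    rw [Algebra.smul_def] at hq
    change f q * _ = _ at hq
    rw [hfmul, hfmul]
    field_simp at hq
    linear_combination -hq

/-- Monotonicity in both directions makes `θ` depend on the content alone, so any choice of
representatives will do. -/
theorem exists_hom_of_contentDivisor [IsIntegrallyClosed R] {G : Type*} [AddCommMonoid G]
    [PartialOrder G] (θ : (FractionRing R)[X] → G) (h1 : θ 1 = 0)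
    (hmul : ∀ f g, f ≠ 0 → g ≠ 0 → θ (f * g) = θ f + θ g)
    (hmono : ∀ f g, f ≠ 0 → g ≠ 0 → contentDivisor f ≤ contentDivisor g → θ f ≤ θ g) :
    ∃ ψ : DivisorGroup R →+ G, Monotone ψ ∧ ∀ f, f ≠ 0 → ψ (contentDivisor f) = θ f := by
  choose p hp hpα using fun α : DivisorGroup R => exists_contentDivisor_eq α
  have key : ∀ f, f ≠ 0 → θ (p (contentDivisor f)) = θ f := fun f hf =>
    le_antisymm (hmono _ _ (hp _) hf (hpα _).le) (hmono _ _ hf (hp _) (hpα _).ge)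
  refine ⟨{ toFun := fun α => θ (p α), map_zero' := ?_, map_add' := ?_ }, ?_, key⟩
  · rw [← contentDivisor_one, key 1 one_ne_zero, h1]
  · intro α β
    rw [← hmul _ _ (hp α) (hp β), ← key _ (mul_ne_zero (hp α) (hp β)),
      contentDivisor_mul (hp α) (hp β), hpα, hpα]
  · intro α β hαβ
    exact hmono _ _ (hp α) (hp β) (by rwa [hpα, hpα])

end DivisorGroup

/-! ### Characteristic polynomials and integrality -/

section Matrix

open Polynomial Matrix

variable {n : Type*} [Fintype n] [DecidableEq n]

/-- `X - M` divides `P(X) - P(M)`, which is the scalar matrix `P(X)`; take determinants. -/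
theorem Matrix.charpoly_dvd_pow_of_aeval_eq_zero {R S : Type*} [CommRing R] [CommRing S]
    [Algebra R S] (M : Matrix n n S) (P : R[X]) (h : aeval M P = 0) :
    M.charpoly ∣ (P.map (algebraMap R S)) ^ Fintype.card n := by
  have hcomm : Commute (scalar n (X : S[X])) (C.mapMatrix M) :=
    scalar_commute _ (fun r => Commute.all _ _) _
  have hdvd : charmatrix M ∣ aeval (scalar n (X : S[X])) P - aeval (C.mapMatrix M) P := by
    rw [aeval_eq_sum_range, aeval_eq_sum_range, ← Finset.sum_sub_distrib]
    refine Finset.dvd_sum fun i _ => ?_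
    rw [← smul_sub, Algebra.smul_def, Algebra.commutes]
    exact (hcomm.sub_dvd_pow_sub_pow i).mul_right _
  have h1 : aeval (C.mapMatrix M) P = 0 := by
    have := congrArg ((CAlgHom (R := R) (A := S)).mapMatrix (m := n)) h
    rw [← aeval_algHom_apply, map_zero] at this
    exact this
  have h2 : aeval (scalar n (X : S[X])) P = scalar n (P.map (algebraMap R S)) := by
    have : aeval (scalar n (X : S[X])) P = scalar n (aeval (X : S[X]) P) := by
      rw [aeval_eq_sum_range, aeval_eq_sum_range, map_sum]
      refine Finset.sum_congr rfl fun i _ => ?_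
      rw [← map_pow]
      ext1 a b
      simp only [Matrix.smul_apply, scalar_apply, diagonal_apply]
      split_ifs <;> simp
    rw [this, aeval_X_left_eq_map]
  rw [h1, sub_zero, h2] at hdvd
  obtain ⟨Q, hQ⟩ := hdvd
  refine ⟨Q.det, ?_⟩
  rw [charpoly, ← det_mul, ← hQ]
  simp

theorem Matrix.isIntegral_coeff_charpoly {R S : Type*} [CommRing R] [CommRing S] [Algebra R S]
    {M : Matrix n n S} (h : IsIntegral R M) (i : ℕ) : IsIntegral R (M.charpoly.coeff i) := by
  obtain ⟨P, hP, hPM⟩ := h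
  refine isIntegral_coeff_of_dvd (P ^ Fintype.card n) _ (hP.pow _) M.charpoly_monic ?_ i
  rw [Polynomial.map_pow]
  exact M.charpoly_dvd_pow_of_aeval_eq_zero P hPM

/-- In `det (1 - X M)` scaling `M` is a substitution for `X`, so no division by `p` is needed. -/
theorem Matrix.charpolyRev_smul {S : Type*} [CommRing S] (p : S) (M : Matrix n n S) :
    (p • M).charpolyRev = M.charpolyRev.comp (C p * X) := by
  rw [charpolyRev, charpolyRev, ← coe_compRingHom_apply, RingHom.map_det]
  congr 1
  ext1 i j
  simp only [RingHom.mapMatrix_apply, map_apply, sub_apply, smul_apply, smul_eq_mul, map_sub,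
    map_mul, coe_compRingHom_apply, X_comp, C_comp, one_apply]
  split_ifs <;> simp <;> ring

theorem Matrix.coeff_charpoly_smul {S : Type*} [CommRing S] (p : S) (M : Matrix n n S) {i : ℕ}
    (hi : i ≤ Fintype.card n) :
    (p • M).charpoly.coeff i = p ^ (Fintype.card n - i) * M.charpoly.coeff i := by
  nontriviality S
  have key : ∀ N : Matrix n n S, N.charpoly.coeff i = N.charpolyRev.coeff (Fintype.card n - i) := by
    intro N
    rw [← reverse_charpoly, coeff_reverse, charpoly_natDegree_eq_dim,
      revAt_le (Nat.sub_le _ _), Nat.sub_sub_self hi]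
  rw [key, key, charpolyRev_smul, comp_C_mul_X_coeff, mul_comm]

end Matrix

/-! ### The norm from `L[X]` to `K[X]` -/

section PolynomialNorm

open Polynomial Matrix

attribute [local instance] Polynomial.algebra

variable {K L n : Type*} [Field K] [Field L] [Algebra K L] [Fintype n] [DecidableEq n]
  (b : Module.Basis n K L)

/-- The matrix of the multiplication by a polynomial over `L` with respect to a basis of `L`. -/
noncomputable def polyMulMatrix : L[X] →+* Matrix n n K[X] :=
  (matPolyEquiv (R := K) (n := n)).symm.toRingHom.comp
    (mapRingHom (Algebra.leftMulMatrix b).toRingHom)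

theorem polyMulMatrix_injective : Function.Injective (polyMulMatrix b) := by
  refine matPolyEquiv.symm.injective.comp (map_injective _ ?_)
  exact Algebra.leftMulMatrix_injective b

theorem polyMulMatrix_C (x : L) :
    polyMulMatrix b (C x) = (Algebra.leftMulMatrix b x).map C := by
  change matPolyEquiv.symm (Polynomial.map _ (C x)) = _
  rw [map_C, matPolyEquiv_symm_C]
  rfl

theorem polyMulMatrix_map (p : K[X]) :
    polyMulMatrix b (p.map (algebraMap K L)) = algebraMap K[X] (Matrix n n K[X]) p := by
  change matPolyEquiv.symm (Polynomial.map _ _) = _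
  rw [Polynomial.map_map, AlgEquiv.symm_apply_eq, Algebra.algebraMap_eq_smul_one,
    matPolyEquiv_smul_one]
  congr 1
  exact (Algebra.leftMulMatrix b).comp_algebraMap

/-- The matrix of multiplication, as a homomorphism of `K[X]`-algebras. -/
noncomputable def polyMulMatrixAlgHom : L[X] →ₐ[K[X]] Matrix n n K[X] :=
  { polyMulMatrix b with commutes' := polyMulMatrix_map b }

/-- The norm of polynomials, extending the norm of `L` over `K`. -/
noncomputable def polyNorm (f : L[X]) : K[X] := (polyMulMatrix b f).det

theorem polyNorm_one : polyNorm b 1 = 1 := by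
  rw [polyNorm, map_one, det_one]

theorem polyNorm_mul (f g : L[X]) : polyNorm b (f * g) = polyNorm b f * polyNorm b g := by
  rw [polyNorm, map_mul, det_mul, polyNorm, polyNorm]

theorem polyNorm_map (p : K[X]) :
    polyNorm b (p.map (algebraMap K L)) = p ^ Fintype.card n := by
  rw [polyNorm, polyMulMatrix_map, algebraMap_eq_diagonal, det_diagonal]
  simp

theorem polyNorm_C (x : L) : polyNorm b (C x) = C (Algebra.norm K x) := by
  rw [polyNorm, polyMulMatrix_C, Algebra.norm_eq_matrix_det b, RingHom.map_det]
  rfl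

theorem aeval_charpoly_polyMulMatrix (f : L[X]) :
    aeval f (polyMulMatrix b f).charpoly = 0 := by
  apply polyMulMatrix_injective b
  rw [map_zero]
  exact (aeval_algHom_apply (polyMulMatrixAlgHom b) f _).symm.trans (aeval_self_charpoly _)

theorem polyNorm_ne_zero {f : L[X]} (hf : f ≠ 0) : polyNorm b f ≠ 0 := by
  have hint : IsAlgebraic K[X] f :=
    IsIntegral.isAlgebraic ⟨_, charpoly_monic _, aeval_charpoly_polyMulMatrix b f⟩
  -- Being algebraic, `f` divides a nonzero `p` of `K[X]`, and the norm of `p` is a power of `p`.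
  obtain ⟨p, hp, g, hg⟩ := hint.exists_nonzero_dvd (mem_nonZeroDivisors_of_ne_zero hf)
  have := congrArg (polyNorm b) hg
  rw [Polynomial.algebraMap_def, coe_mapRingHom, polyNorm_map, polyNorm_mul] at this
  exact left_ne_zero_of_mul (this ▸ pow_ne_zero _ hp)

variable {A : Type*} [CommRing A] [Algebra A K] [Algebra A L] [IsScalarTower A K L]

theorem isIntegral_coeff_charpoly_polyMulMatrix {f : L[X]} (hf : IsIntegral A[X] f) (i : ℕ) :
    IsIntegral A[X] ((polyMulMatrix b f).charpoly.coeff i) :=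
  isIntegral_coeff_charpoly (hf.map ((polyMulMatrixAlgHom b).restrictScalars A[X])) i

theorem isIntegral_polyNorm {f : L[X]} (hf : IsIntegral A[X] f) :
    IsIntegral A[X] (polyNorm b f) := by
  rw [polyNorm, det_eq_sign_charpoly_coeff]
  exact ((isIntegral_one.neg).pow _).mul (isIntegral_coeff_charpoly_polyMulMatrix b hf 0)

/-- The complementary factor of a polynomial in its norm. -/
theorem exists_mul_eq_polyNorm (f : L[X]) : ∃ g : L[X],
    f * g = (polyNorm b f).map (algebraMap K L) ∧ (IsIntegral A[X] f → IsIntegral A[X] g) := by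
  let χ := (polyMulMatrix b f).charpoly
  -- Cayley–Hamilton gives `f * χ.divX(f) = -χ(0)`, while the norm is `(-1) ^ n * χ(0)`; this
  -- accounts for the exponent `n + 1`.
  refine ⟨(-1) ^ (Fintype.card n + 1) * aeval f χ.divX, ?_, fun hf => ?_⟩
  · have h0 := aeval_charpoly_polyMulMatrix b f
    rw [← divX_mul_X_add (polyMulMatrix b f).charpoly, map_add, map_mul, aeval_X, aeval_C,
      Polynomial.algebraMap_def, coe_mapRingHom] at h0
    rw [polyNorm, det_eq_sign_charpoly_coeff, Polynomial.map_mul, Polynomial.map_pow,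
      Polynomial.map_neg, Polynomial.map_one]
    linear_combination (-1) ^ (Fintype.card n + 1) * h0
  · refine ((isIntegral_one.neg).pow _).mul ?_
    rw [aeval_eq_sum_range]
    refine IsIntegral.sum _ fun i _ => ?_
    rw [Algebra.smul_def, coeff_divX]
    refine IsIntegral.mul ?_ (hf.pow i)
    exact (isIntegral_coeff_charpoly_polyMulMatrix b hf (i + 1)).algebraMap

theorem isIntegral_of_isIntegral_coeff_charpoly {f : L[X]}
    (h : ∀ i, IsIntegral A[X] ((polyMulMatrix b f).charpoly.coeff i)) : IsIntegral A[X] f := by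
  have : Nonempty n := b.index_nonempty
  refine IsIntegral.of_aeval_monic_of_isIntegral_coeff
    (p := (polyMulMatrix b f).charpoly.map (algebraMap K[X] L[X]))
    ((charpoly_monic _).map _) ?_ ?_ ?_
  · rw [(charpoly_monic _).natDegree_map, charpoly_natDegree_eq_dim]
    exact Fintype.card_ne_zero
  · rw [eval_map_algebraMap, aeval_charpoly_polyMulMatrix]
    exact isIntegral_zero
  · intro i
    rw [coeff_map]
    exact (h i).algebraMap

theorem coeff_charpoly_polyMulMatrix_C_mul (z : L) (p : K[X]) {i : ℕ} (hi : i ≤ Fintype.card n) :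
    (polyMulMatrix b (C z * p.map (algebraMap K L))).charpoly.coeff i =
      C ((Algebra.leftMulMatrix b z).charpoly.coeff i) * p ^ (Fintype.card n - i) := by
  rw [map_mul, polyMulMatrix_map, ← Algebra.commutes, mul_comm (C _), ← Algebra.smul_def, coeff_charpoly_smul _ _ hi,
    polyMulMatrix_C]
  change _ * (((Algebra.leftMulMatrix b z).map (C : K →+* K[X])).charpoly).coeff i = _
  rw [charpoly_map, coeff_map]

end PolynomialNorm

/-! ### Extension and norm of divisors -/

namespace DivisorGroup

open Polynomial

attribute [local instance] Polynomial.algebra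

variable {A B n : Type*} [CommRing A] [IsDomain A] [CommRing B] [IsDomain B] [Algebra A B]
  [Algebra (FractionRing A) (FractionRing B)]
  [IsScalarTower A (FractionRing A) (FractionRing B)] [Fintype n] [DecidableEq n]
  (b : Module.Basis n (FractionRing A) (FractionRing B))

/-- Used for `B` and also with `B = A`, so that positivity over both rings is the same integrality
condition over `A[X]`. -/
theorem zero_le_contentDivisor_iff_isIntegral [Algebra.IsIntegral A B] [IsIntegrallyClosed B]
    {f : (FractionRing B)[X]} (hf : f ≠ 0) : 0 ≤ contentDivisor f ↔ IsIntegral A[X] f := by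
  rw [zero_le_contentDivisor hf, isIntegral_iff_isIntegral_coeff]
  refine forall_congr' fun i => ⟨?_, fun h => ?_⟩
  · rintro ⟨y, hy⟩
    rw [← hy]
    exact (Algebra.IsIntegral.isIntegral (R := A) y).algebraMap
  · exact IsIntegrallyClosed.isIntegral_iff.mp (h.tower_top (A := B))

theorem map_algebraMap_ne_zero {p : (FractionRing A)[X]} (hp : p ≠ 0) :
    p.map (algebraMap (FractionRing A) (FractionRing B)) ≠ 0 :=
  (Polynomial.map_ne_zero_iff (algebraMap (FractionRing A) (FractionRing B)).injective).mpr hp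

section PvMD

variable [IsPvMD A]

theorem exists_contentDivisor_add_eq_zero (p : (FractionRing A)[X]) :
    ∃ q : (FractionRing A)[X], q ≠ 0 ∧ contentDivisor p + contentDivisor q = 0 := by
  obtain ⟨q, hq, h⟩ := exists_contentDivisor_eq (-contentDivisor p)
  exact ⟨q, hq, by rw [h, add_neg_cancel]⟩

include b in
-- Integrality of the characteristic coefficients `c * p ^ (n - i)` is the inequality `0 ≤ div c +
-- (n - i) • div p`, which survives replacing `p` by `q`.
theorem isIntegral_C_mul_map_of_contentDivisor_le {p q : (FractionRing A)[X]} (hp : p ≠ 0)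
    (hq : q ≠ 0) (h : contentDivisor p ≤ contentDivisor q) {z : FractionRing B}
    (hz : IsIntegral A[X] (C z * p.map (algebraMap (FractionRing A) (FractionRing B)))) :
    IsIntegral A[X] (C z * q.map (algebraMap (FractionRing A) (FractionRing B))) := by
  have := IsPvMD.isIntegrallyClosed (R := A)
  refine isIntegral_of_isIntegral_coeff_charpoly b fun i => ?_
  rcases le_or_gt i (Fintype.card n) with hi | hi
  · have h1 := isIntegral_coeff_charpoly_polyMulMatrix b hz i
    rw [coeff_charpoly_polyMulMatrix_C_mul b z _ hi] at h1 ⊢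
    set c := (Algebra.leftMulMatrix b z).charpoly.coeff i
    -- The zero polynomial has the default content `0`, so additivity of contents is unavailable
    -- here.
    by_cases hc : c = 0
    · rw [hc, C_0, zero_mul]
      exact isIntegral_zero
    have hc' : (C c : (FractionRing A)[X]) ≠ 0 := C_ne_zero.mpr hc
    rw [← zero_le_contentDivisor_iff_isIntegral (mul_ne_zero hc' (pow_ne_zero _ hp)),
      contentDivisor_mul hc' (pow_ne_zero _ hp), contentDivisor_pow hp] at h1
    rw [← zero_le_contentDivisor_iff_isIntegral (mul_ne_zero hc' (pow_ne_zero _ hq)),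
      contentDivisor_mul hc' (pow_ne_zero _ hq), contentDivisor_pow hq]
    exact h1.trans (add_le_add_right (nsmul_le_nsmul_right h _) _)
  · rw [coeff_eq_zero_of_natDegree_lt (by rwa [Matrix.charpoly_natDegree_eq_dim])]
    exact isIntegral_zero

variable [Algebra.IsIntegral A B] [IsIntegrallyClosed B]

include b in
theorem contentDivisor_map_mono {p q : (FractionRing A)[X]} (hp : p ≠ 0)
    (hq : q ≠ 0) (h : contentDivisor p ≤ contentDivisor q) :
    contentDivisor (p.map (algebraMap (FractionRing A) (FractionRing B))) ≤
      contentDivisor (q.map (algebraMap (FractionRing A) (FractionRing B))) := by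
  have hp' := map_algebraMap_ne_zero (B := B) hp
  have hq' := map_algebraMap_ne_zero (B := B) hq
  rw [contentDivisor_le hp' hq']
  intro y hy
  have hy0 := ne_zero_of_coeffSpan_le hp' hy
  have hyC : (C y⁻¹ : (FractionRing B)[X]) ≠ 0 := C_ne_zero.mpr (inv_ne_zero hy0)
  -- Divisibility of the coefficients by `y` becomes integrality of `y⁻¹ * f`.
  have key : ∀ f : (FractionRing B)[X], f ≠ 0 →
      (coeffSpan f ≤ Submodule.span B {y} ↔ IsIntegral A[X] (C y⁻¹ * f)) := by
    intro f hf
    rw [← zero_le_contentDivisor_iff_isIntegral (mul_ne_zero hyC hf),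
      zero_le_contentDivisor (mul_ne_zero hyC hf), coeffSpan_le]
    refine forall_congr' fun i => ?_
    rw [mem_span_singleton_iff_div hy0, coeff_C_mul]
  rw [key _ hq']
  exact isIntegral_C_mul_map_of_contentDivisor_le b hp hq h ((key _ hp').mp hy)

include b in
theorem contentDivisor_map_eq_zero {p : (FractionRing A)[X]} (hp : p ≠ 0)
    (h : contentDivisor p = 0) :
    contentDivisor (p.map (algebraMap (FractionRing A) (FractionRing B))) = 0 := by
  have h1 : contentDivisor ((1 : (FractionRing A)[X]).map
      (algebraMap (FractionRing A) (FractionRing B))) = 0 := by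
    rw [Polynomial.map_one, contentDivisor_one]
  rw [← contentDivisor_one] at h
  rw [← h1]
  exact le_antisymm (contentDivisor_map_mono b hp one_ne_zero h.le)
    (contentDivisor_map_mono b one_ne_zero hp h.ge)

include b in
/-- The integral closure of a domain with divisors in a finite extension is a domain with
divisors. -/
theorem isPvMD_of_basis : IsPvMD B := by
  apply isPvMD_of_forall_exists_add_eq_zero
  intro α
  obtain ⟨f, hf, rfl⟩ := exists_contentDivisor_eq α
  obtain ⟨g, hfg, -⟩ := exists_mul_eq_polyNorm (A := A) b f
  have hN := polyNorm_ne_zero b hf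
  obtain ⟨q, hq, hq0⟩ := exists_contentDivisor_add_eq_zero (polyNorm b f)
  have := IsPvMD.isIntegrallyClosed (R := A)
  rw [← contentDivisor_mul hN hq] at hq0
  -- `f * g` is the norm of `f` and `q` inverts the content of that norm, so `g * q` provides the
  -- inverse divisor.
  have h0 := contentDivisor_map_eq_zero (B := B) b (mul_ne_zero hN hq) hq0
  rw [Polynomial.map_mul, ← hfg, mul_assoc] at h0
  have hg : g ≠ 0 := right_ne_zero_of_mul (hfg ▸ map_algebraMap_ne_zero hN)
  rw [contentDivisor_mul hf (mul_ne_zero hg (map_algebraMap_ne_zero hq))] at h0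
  exact ⟨_, h0⟩

include b in
-- Adding an inverse of the content of `p` turns the comparison into positivity, that is,
-- integrality over `A[X]`, which descends from `L[X]` to `K[X]`.
theorem contentDivisor_le_of_map_le {p q : (FractionRing A)[X]} (hp : p ≠ 0) (hq : q ≠ 0)
    (h : contentDivisor (p.map (algebraMap (FractionRing A) (FractionRing B))) ≤
      contentDivisor (q.map (algebraMap (FractionRing A) (FractionRing B)))) :
    contentDivisor p ≤ contentDivisor q := by
  have := IsPvMD.isIntegrallyClosed (R := A)
  obtain ⟨r, hr, hr0⟩ := exists_contentDivisor_add_eq_zero p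
  have hpr : contentDivisor ((p * r).map (algebraMap (FractionRing A) (FractionRing B))) = 0 :=
    contentDivisor_map_eq_zero b (mul_ne_zero hp hr) (by rw [contentDivisor_mul hp hr, hr0])
  have hqr : 0 ≤ contentDivisor ((q * r).map (algebraMap (FractionRing A) (FractionRing B))) := by
    rw [← hpr, Polynomial.map_mul, Polynomial.map_mul,
      contentDivisor_mul (map_algebraMap_ne_zero hp) (map_algebraMap_ne_zero hr),
      contentDivisor_mul (map_algebraMap_ne_zero hq) (map_algebraMap_ne_zero hr)]
    exact add_le_add_left h _
  rw [zero_le_contentDivisor_iff_isIntegral (A := A)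
    (map_algebraMap_ne_zero (mul_ne_zero hq hr))] at hqr
  have hqr' : IsIntegral A[X] (q * r) :=
    (isIntegral_algebraMap_iff (A := (FractionRing A)[X]) (B := (FractionRing B)[X])
      (map_injective _ (algebraMap (FractionRing A) (FractionRing B)).injective)).mp hqr
  rw [← zero_le_contentDivisor_iff_isIntegral (mul_ne_zero hq hr), contentDivisor_mul hq hr,
    ← hr0] at hqr'
  exact le_of_add_le_add_right hqr'

include b in
theorem exists_isDivisorInclusion [IsPvMD B] :
    ∃ φ : DivisorGroup A →+ DivisorGroup B, IsDivisorInclusion φ ∧ ∀ p, p ≠ 0 →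
      φ (contentDivisor p) =
        contentDivisor (p.map (algebraMap (FractionRing A) (FractionRing B))) := by
  have := IsPvMD.isIntegrallyClosed (R := A)
  obtain ⟨φ, -, hφ⟩ := exists_hom_of_contentDivisor
    (fun p => contentDivisor (p.map (algebraMap (FractionRing A) (FractionRing B))))
    (by rw [Polynomial.map_one, contentDivisor_one])
    (fun f g hf hg => by
      rw [Polynomial.map_mul,
        contentDivisor_mul (map_algebraMap_ne_zero hf) (map_algebraMap_ne_zero hg)])
    (fun f g hf hg => contentDivisor_map_mono b hf hg)
  have hinf : ∀ α β, φ (α ⊓ β) = φ α ⊓ φ β := by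
    intro α β
    obtain ⟨f, hf, rfl⟩ := exists_contentDivisor_eq α
    obtain ⟨g, hg, rfl⟩ := exists_contentDivisor_eq β
    obtain ⟨h0, hglb⟩ := isGLB_contentDivisor hf hg (Nat.lt_succ_self _)
    rw [isGLB_pair.unique hglb, hφ _ h0, hφ f hf, hφ g hg]
    refine IsGLB.unique ?_ isGLB_pair
    rw [Polynomial.map_add, Polynomial.map_mul, Polynomial.map_pow, map_X]
    exact (isGLB_contentDivisor (map_algebraMap_ne_zero hf) (map_algebraMap_ne_zero hg)
      (by rw [natDegree_map]; exact Nat.lt_succ_self _)).2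
  refine ⟨φ, ⟨?_, hinf, ?_, ?_⟩, hφ⟩
  · intro α β hαβ
    obtain ⟨f, hf, rfl⟩ := exists_contentDivisor_eq α
    obtain ⟨g, hg, rfl⟩ := exists_contentDivisor_eq β
    rw [hφ f hf, hφ g hg] at hαβ
    exact le_antisymm (contentDivisor_le_of_map_le b hf hg hαβ.le)
      (contentDivisor_le_of_map_le b hg hf hαβ.ge)
  · intro α β
    rw [← neg_neg (α ⊔ β), neg_sup, map_neg, hinf, map_neg, map_neg, neg_inf, neg_neg, neg_neg]
  · intro a ha hb
    rw [← contentDivisor_C_algebraMap ha, ← contentDivisor_C_algebraMap hb,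
      hφ _ (C_ne_zero.mpr ((map_ne_zero_iff _ (IsFractionRing.injective A _)).mpr ha)), map_C,
      ← IsScalarTower.algebraMap_apply A (FractionRing A) (FractionRing B),
      ← IsScalarTower.algebraMap_apply A B (FractionRing B)]

/-- The content of `f' * q` is inverse to that of `f`, so `g * f' * q` is integral over `A[X]`, and
so is its norm. -/
theorem contentDivisor_polyNorm_mono [IsPvMD B] {f g : (FractionRing B)[X]} (hf : f ≠ 0)
    (hg : g ≠ 0) (h : contentDivisor f ≤ contentDivisor g) :
    contentDivisor (polyNorm b f) ≤ contentDivisor (polyNorm b g) := by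
  have := IsPvMD.isIntegrallyClosed (R := A)
  have hNf := polyNorm_ne_zero b hf
  have hNg := polyNorm_ne_zero b hg
  obtain ⟨f', hff', -⟩ := exists_mul_eq_polyNorm (A := A) b f
  have hf' : f' ≠ 0 := right_ne_zero_of_mul (hff' ▸ map_algebraMap_ne_zero hNf)
  have hNf' := polyNorm_ne_zero b hf'
  obtain ⟨q, hq, hq0⟩ := exists_contentDivisor_add_eq_zero (polyNorm b f)
  have hq' := map_algebraMap_ne_zero (B := B) hq
  have h0 : contentDivisor f + contentDivisor
      (f' * q.map (algebraMap (FractionRing A) (FractionRing B))) = 0 := by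
    rw [← contentDivisor_mul hf (mul_ne_zero hf' hq'), ← mul_assoc, hff', ← Polynomial.map_mul]
    exact contentDivisor_map_eq_zero b (mul_ne_zero hNf hq)
      (by rw [contentDivisor_mul hNf hq, hq0])
  have h1 := h0.symm.le.trans (add_le_add_left h _)
  rw [← contentDivisor_mul hg (mul_ne_zero hf' hq'), zero_le_contentDivisor_iff_isIntegral (A := A)
    (mul_ne_zero hg (mul_ne_zero hf' hq'))] at h1
  have h2 := isIntegral_polyNorm b h1
  have hqn := pow_ne_zero (Fintype.card n) hq
  rw [polyNorm_mul, polyNorm_mul, polyNorm_map, ← zero_le_contentDivisor_iff_isIntegral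
    (mul_ne_zero hNg (mul_ne_zero hNf' hqn)), contentDivisor_mul hNg (mul_ne_zero hNf' hqn),
    contentDivisor_mul hNf' hqn, contentDivisor_pow hq] at h2
  -- The norm of `f * f' = N(f)` is `N(f) * N(f') = N(f) ^ n`, so `f' * q` has norm content `-div
  -- N(f)`.
  have h3 := congrArg (fun p => contentDivisor (polyNorm b p)) hff'
  simp only [polyNorm_mul, polyNorm_map] at h3
  rw [contentDivisor_mul hNf hNf', contentDivisor_pow hNf] at h3
  have h4 : contentDivisor (polyNorm b f') + Fintype.card n • contentDivisor q =
      -contentDivisor (polyNorm b f) := by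
    rw [eq_neg_of_add_eq_zero_right hq0, smul_neg, ← h3]
    abel
  rw [h4] at h2
  exact sub_nonneg.mp (by rwa [sub_eq_add_neg])

theorem exists_norm [IsPvMD B] :
    ∃ N : DivisorGroup B →+ DivisorGroup A, Monotone N ∧ ∀ f, f ≠ 0 →
      N (contentDivisor f) = contentDivisor (polyNorm b f) := by
  have := IsPvMD.isIntegrallyClosed (R := A)
  exact exists_hom_of_contentDivisor (fun f => contentDivisor (polyNorm b f))
    (by rw [polyNorm_one, contentDivisor_one])
    (fun f g hf hg => by
      rw [polyNorm_mul, contentDivisor_mul (polyNorm_ne_zero b hf) (polyNorm_ne_zero b hg)])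
    (fun f g hf hg => contentDivisor_polyNorm_mono b hf hg)

/-- The cofactor of `f` in its norm is integral too, so two nonnegative contents add up to zero. -/
theorem contentDivisor_eq_zero_of_polyNorm [IsPvMD B] {f : (FractionRing B)[X]} (hf : f ≠ 0)
    (h : 0 ≤ contentDivisor f) (h0 : contentDivisor (polyNorm b f) = 0) :
    contentDivisor f = 0 := by
  obtain ⟨g, hfg, hg⟩ := exists_mul_eq_polyNorm (A := A) b f
  have hN := polyNorm_ne_zero b hf
  have hg0 : g ≠ 0 := right_ne_zero_of_mul (hfg ▸ map_algebraMap_ne_zero hN)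
  have hg' := (zero_le_contentDivisor_iff_isIntegral hg0).mpr
    (hg ((zero_le_contentDivisor_iff_isIntegral hf).mp h))
  have h1 := contentDivisor_map_eq_zero (B := B) b hN h0
  rw [← hfg, contentDivisor_mul hf hg0] at h1
  exact ((add_eq_zero_iff_of_nonneg h hg').mp h1).1

end PvMD

/-- The extension and norm of divisors for an integral extension of domains whose fraction fields
form a finite extension. -/
theorem exists_inclusion_and_norm [Algebra.IsIntegral A B] [IsIntegrallyClosed B]
    [FiniteDimensional (FractionRing A) (FractionRing B)] [IsPvMD A] :
    ∃ _ : IsPvMD B, ∃ φ : DivisorGroup A →+ DivisorGroup B, IsDivisorInclusion φ ∧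
      ∃ N : DivisorGroup B →+ DivisorGroup A, Monotone N ∧
        (∀ (x : B) (hx : x ≠ 0), ∃ (a : A) (ha : a ≠ 0),
          algebraMap A (FractionRing A) a =
            Algebra.norm (FractionRing A) (algebraMap B (FractionRing B) x) ∧
          N (dv x hx) = dv a ha) ∧
        (∀ β, 0 ≤ β → (β = 0 ↔ N β = 0)) ∧
        (∀ α, N (φ α) = Module.finrank (FractionRing A) (FractionRing B) • α) := by
  let b := Module.finBasis (FractionRing A) (FractionRing B)
  have := IsPvMD.isIntegrallyClosed (R := A)
  have hB : IsPvMD B := isPvMD_of_basis b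
  obtain ⟨φ, hφ, hφc⟩ := exists_isDivisorInclusion b
  obtain ⟨N, hN, hNc⟩ := exists_norm b
  refine ⟨hB, φ, hφ, N, hN, fun x hx => ?_, fun β hβ => ⟨?_, fun h => ?_⟩, fun α => ?_⟩
  · have hx' : algebraMap B (FractionRing B) x ≠ 0 :=
      (map_ne_zero_iff _ (IsFractionRing.injective B _)).mpr hx
    have hint : IsIntegral A (Algebra.norm (FractionRing A) (algebraMap B (FractionRing B) x)) :=
      Algebra.isIntegral_norm _ (Algebra.IsIntegral.isIntegral (R := A) x).algebraMap
    obtain ⟨a, ha⟩ := IsIntegrallyClosed.isIntegral_iff.mp hint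
    have ha0 : a ≠ 0 := by
      rintro rfl
      rw [map_zero] at ha
      exact Algebra.norm_ne_zero_iff.mpr hx' ha.symm
    refine ⟨a, ha0, ha, ?_⟩
    rw [← contentDivisor_C_algebraMap hx, ← contentDivisor_C_algebraMap ha0,
      hNc _ (C_ne_zero.mpr hx'), polyNorm_C, ha]
  · rintro rfl
    exact map_zero N
  · obtain ⟨f, hf, rfl⟩ := exists_contentDivisor_eq β
    rw [hNc f hf] at h
    exact contentDivisor_eq_zero_of_polyNorm b hf hβ h
  · obtain ⟨p, hp, rfl⟩ := exists_contentDivisor_eq α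
    rw [hφc p hp, hNc _ (map_algebraMap_ne_zero hp), polyNorm_map, contentDivisor_pow hp,
      Fintype.card_fin]

end DivisorGroup

/-! ### Bounded decomposition and arbitrary fraction fields -/

theorem HasBoundedDecomposition.of_hom {G H : Type*} [AddCommGroup G] [Lattice G] [AddCommGroup H]
    [Lattice H] (N : G →+ H) (hN : Monotone N) (h0 : ∀ x, 0 ≤ x → N x = 0 → x = 0)
    (hH : HasBoundedDecomposition H) : HasBoundedDecomposition G := by
  intro x hx
  obtain ⟨n, hn, h⟩ := hH (N x) (map_zero N ▸ hN hx)
  refine ⟨n, hn, fun y hy hxy => ?_⟩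
  obtain ⟨j, hj⟩ := h (fun j => N (y j)) (fun j => map_zero N ▸ hN (hy j)) (by rw [hxy, map_sum])
  exact ⟨j, h0 _ (hy j) hj⟩

theorem mainTheorem8 {A K L : Type*} [CommRing A] [IsDomain A] [Field K] [Algebra A K]
    [IsFractionRing A K] [Field L] [Algebra K L] [Algebra A L] [IsScalarTower A K L]
    [FiniteDimensional K L] :
    (IsKrullDomain A → IsKrullDomain (integralClosure A L)) ∧
    ∀ [IsPvMD A], ∃ _ : IsPvMD (integralClosure A L),
      ∃ φ : DivisorGroup A →+ DivisorGroup (integralClosure A L), IsDivisorInclusion φ ∧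
      ∃ N : DivisorGroup (integralClosure A L) →+ DivisorGroup A, Monotone N ∧
        (∀ (b : integralClosure A L) (hb : b ≠ 0), ∃ (a : A) (ha : a ≠ 0),
          algebraMap A K a = Algebra.norm K (b : L) ∧
          N (DivisorGroup.dv b hb) = DivisorGroup.dv a ha) ∧
        (∀ β, 0 ≤ β → (β = 0 ↔ N β = 0)) ∧
        (∀ α, N (φ α) = Module.finrank K L • α) := by
  have hBL : IsFractionRing (integralClosure A L) L :=
    integralClosure.isFractionRing_of_finite_extension K L
  have hBc : IsIntegrallyClosed (integralClosure A L) :=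
    integralClosure.isIntegrallyClosedOfFiniteExtension K
  let e := FractionRing.algEquiv A K
  let e' := FractionRing.algEquiv (integralClosure A L) L
  -- Divisors live in the standard fraction rings, so the extension `L` of `K` is transported to
  -- them; norm and degree are carried along by `hcomm`.
  let ι : FractionRing A →+* FractionRing (integralClosure A L) :=
    (e'.symm : L →+* _).comp ((algebraMap K L).comp (e : FractionRing A →+* K))
  let : Algebra (FractionRing A) (FractionRing (integralClosure A L)) := ι.toAlgebra
  have hcomm : (algebraMap K L).comp (e.toRingEquiv : FractionRing A →+* K) =
      (e'.toRingEquiv : FractionRing (integralClosure A L) →+* L).comp (algebraMap (FractionRing A) (FractionRing (integralClosure A L))) := by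
    ext x
    exact (e'.apply_symm_apply _).symm
  have : IsScalarTower A (FractionRing A) (FractionRing (integralClosure A L)) := by
    refine IsScalarTower.of_algebraMap_eq fun a => e'.injective ?_
    refine Eq.trans ?_ (e'.apply_symm_apply _).symm
    change _ = algebraMap K L (e (algebraMap A (FractionRing A) a))
    rw [e.commutes, IsScalarTower.algebraMap_apply A (integralClosure A L) (FractionRing _),
      e'.commutes, ← IsScalarTower.algebraMap_apply, ← IsScalarTower.algebraMap_apply]
  have hfin : Module.finrank (FractionRing A) (FractionRing (integralClosure A L)) =
      Module.finrank K L := Algebra.finrank_eq_of_equiv_equiv e.toRingEquiv e'.toRingEquiv hcomm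
  have : FiniteDimensional (FractionRing A) (FractionRing (integralClosure A L)) :=
    FiniteDimensional.of_finrank_pos (hfin ▸ Module.finrank_pos)
  have main := fun [IsPvMD A] =>
    DivisorGroup.exists_inclusion_and_norm (A := A) (B := integralClosure A L)
  refine ⟨fun hA => ?_, ?_⟩
  · obtain ⟨hB, -, -, N, hN, -, hN0, -⟩ := main
    exact ⟨⟨Classical.decRel _⟩,
      hA.bounded.of_hom N hN fun x hx h => (hN0 x hx).mpr h⟩
  · intro hA
    obtain ⟨hB, φ, hφ, N, hN, hNdv, hN0, hNφ⟩ := main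
    refine ⟨hB, φ, hφ, N, hN, fun b hb => ?_, hN0, fun α => hfin ▸ hNφ α⟩
    obtain ⟨a, ha, hab, hNa⟩ := hNdv b hb
    refine ⟨a, ha, ?_, hNa⟩
    rw [← e.commutes, hab,
      Algebra.norm_eq_of_equiv_equiv e.toRingEquiv e'.toRingEquiv hcomm]
    change e (e.symm _) = _
    rw [e.apply_symm_apply]
    exact congrArg _ (e'.commutes b)
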